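/- Let $\alpha_1,\ldots,\alpha_m\in(0,1)$ satisfy $\sum_{i=1}^m\alpha_i=1$, and let $f:[0,1]^m\to\mathbb{C}$ be Lebesgue integrable. Equalities between functions are understood almost everywhere. Let $f=\sum_{S\subseteq[m]}F_S$, where $[m]=\{1,\ldots,m\}$, be the generalized Walsh (Hoeffding) expansion of $f$; that is, the $F_S:[0,1]^m\to\mathbb{C}$ are integrable, each $F_S$ depends only on the coordinates in $S$, and $\int_0^1F_S(x)\,dx_i=0$ for every $S\subseteq[m]$ and every $i\in S$. Then $$\int_{A_1\times\cdots\times A_m}f=0$$ for all partitions of $[0,1]$ into disjoint measurable sets $A_1,\ldots,A_m$ of respective Lebesgue measures $\alpha_1,\ldots,\alpha_m$ if and only if the following three conditions hold: (i) $F_\emptyset=0$; (ii) for every $S\subseteq[m]$ with $|S|\ge2$, the function $F_S$ is alternating with respect to the coordinates in $S$, i.e. interchanging the values of any two coordinates in $S$ changes the sign of $F_S$; (iii) for every $S\subseteq[m]$ with $1\le|S|\le m-1$ and every $\ell\in[m]\setminus S$, $$\frac{1}{\prod_{i\in S}\alpha_i}F_S(x)=\sum_{i\in S}\frac{1}{\prod_{j\in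 S_i}\alpha_j}F_{S_i}(x^{(i)}),$$ where $S_i:=(S\cup\{\ell\})\setminus\{i\}$ and $x^{(i)}$ is obtained from $x=(x_1,\ldots,x_m)$ by swapping $x_\ell$ and $x_i$. -/

import Mathlib

open MeasureTheory unitInterval

/-- `F` is the generalized Walsh (Hoeffding) expansion of `f : [0,1]^m → ℂ`. The cube carries the
product of the Lebesgue measures, and equalities of functions are meant almost everywhere. -/
structure IsWalshExpansion {m : ℕ} (f : (Fin m → I) → ℂ)
    (F : Finset (Fin m) → (Fin m → I) → ℂ) : Prop where
  integrable : ∀ S, Integrable (F S) volume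
  sum_eq : ∀ᵐ x : Fin m → I, f x = ∑ S : Finset (Fin m), F S x
  dependsOn : ∀ S, DependsOn (F S) (S : Set (Fin m))
  integral_eq_zero : ∀ S, ∀ i ∈ S, ∀ᵐ x : Fin m → I,
    ∫ t : I, F S (Function.update x i t) = 0

/-- `g` is alternating with respect to the coordinates in `S`: interchanging the values of any two
of these coordinates changes the sign of `g` (almost everywhere). -/
def IsAlternatingOn {m : ℕ} (g : (Fin m → I) → ℂ) (S : Finset (Fin m)) : Prop :=
  ∀ i ∈ S, ∀ j ∈ S, i ≠ j → ∀ᵐ x : Fin m → I, g (x ∘ Equiv.swap i j) = - g x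

/-- `A` is a partition of `[0,1]` into measurable sets `A i` of measure `α i`. -/
structure IsMeasurePartition {m : ℕ} (α : Fin m → ℝ) (A : Fin m → Set I) : Prop where
  measurableSet : ∀ i, MeasurableSet (A i)
  disjoint : Pairwise fun i j => Disjoint (A i) (A j)
  iUnion_eq : ⋃ i, A i = Set.univ
  volume_eq : ∀ i, volume (A i) = ENNReal.ofReal (α i)

/-!
Test functions `u i : I → ℝ` turn the statement into multilinear algebra. Put
`Γ S u = (∏ i ∈ S, α i)⁻¹ ∫ F S x ∏ i ∈ S, u i (x i)` (`normPairing`).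

*Expansion.* If `v i` has mean zero, then `∫ F S ∏ i ∈ T, v i (x i) = 0` unless `T = S`. Expanding
the product over all coordinates therefore gives
`∫ f ∏ i, (α i + v i (x i)) = (∏ i, α i) ∑ S, Γ S v` (`pairing_add_const_eq_sum`). With
`v i = 1_{A i} - α i` the left-hand side is the integral of `f` over `A 1 × ⋯ × A m`, and the `v i`
sum up to zero.

*From partitions to multilinear identities.* Since `I` has no atoms, every fractional partition
(`h i ≥ 0`, `∑ i, h i = 1`, `∫ h i = α i`) agrees with some partition on any given finite family of
measurable sets, and hence is a weak-* limit of partitions. So `∫ f ∏ i, h i (x i) = 0` for every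
fractional partition (`pairing_eq_zero_of_fractional`). Taking `h i = α i + ε v i` and comparing
coefficients of `ε` yields, for every `k` and all `u` with `∑ i, u i = 0`,
`∑_{#S = k} Γ S u = 0` (`sum_normPairing_powersetCard_eq_zero`).

*The conditions in weak form.* Products of one-variable functions separate integrable functions,
so (ii) says that `Γ S u = 0` whenever `u i = u j` for distinct `i, j ∈ S`, and (iii) says that
`Γ S u` is the sum over `i ∈ S` of `Γ` at `(S ∪ {l}) \ {i}` with `u i` put into slot `l`
(`isAlternatingOn_iff_normPairing_eq_zero`, `ae_exchange_iff_normPairing`).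

*Necessity.* In the degree `k` identity let `u` be free on a set `S`, equal to `-∑ i ∈ S, u i` at
`l ∉ S`, and zero elsewhere. For `k = #S + 1` only `S ∪ {l}` contributes, and the part quadratic in
one `u j` is (ii); for `k = #S` only `S` and its exchanges with `l` contribute, which gives (iii).

*Sufficiency.* Fix `l`. Condition (iii) rewrites `Γ S v` for `l ∉ S`; for `l ∈ T` substitute
`v l = -∑_{j ≠ l} v j` and drop the terms `j ∈ T` by (ii). The two resulting sums are indexed by
the pairs `(S, i ∈ S)` and `(T, j ∉ T)`, which correspond under exchanging `i` and `l`, and they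
cancel (`sum_normPairing_eq_zero`).
-/

/-! ### Fubini in one coordinate -/

lemma measurePreserving_update {m : ℕ} (i : Fin m) :
    MeasurePreserving (fun p : (Fin m → I) × I => Function.update p.1 i p.2)
      (volume.prod volume) volume := by
  have hmeas : Measurable fun p : (Fin m → I) × I => Function.update p.1 i p.2 := by
    refine measurable_pi_iff.2 fun j => ?_
    rcases eq_or_ne j i with rfl | hj
    · simpa using measurable_snd
    · simpa [hj, Function.comp_def] using (measurable_pi_apply j).comp measurable_fst
  refine ⟨hmeas, ?_⟩
  rw [volume_pi]
  refine (Measure.pi_eq fun s hs => ?_).symm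
  rw [Measure.map_apply hmeas (MeasurableSet.univ_pi hs)]
  have : (fun p : (Fin m → I) × I => Function.update p.1 i p.2) ⁻¹' Set.univ.pi s =
      (Set.univ.pi (Function.update s i Set.univ)) ×ˢ s i := by
    ext p
    simp only [Set.mem_preimage, Set.mem_pi, Set.mem_univ, true_implies, Set.mem_prod]
    constructor
    · refine fun h => ⟨fun j => ?_, by simpa using h i⟩
      rcases eq_or_ne j i with rfl | hj
      · simp
      · simpa [hj] using h j
    · rintro ⟨h, h'⟩ j
      rcases eq_or_ne j i with rfl | hj
      · simpa using h'
      · simpa [hj] using h j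
  rw [this, Measure.prod_prod, Measure.pi_pi,
    ← Finset.mul_prod_erase _ _ (Finset.mem_univ i),
    ← Finset.mul_prod_erase (Finset.univ) (fun j => volume (s j)) (Finset.mem_univ i)]
  simp only [Function.update_self, measure_univ, one_mul]
  rw [mul_comm]
  congr 1
  exact Finset.prod_congr rfl fun j hj => by simp [Finset.ne_of_mem_erase hj]

lemma integral_eq_integral_update {m : ℕ} {G : (Fin m → I) → ℂ} (hG : Integrable G volume)
    (i : Fin m) : ∫ x, G x = ∫ x, ∫ t, G (Function.update x i t) := by
  have h := measurePreserving_update i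
  have hG' : Integrable (fun p : (Fin m → I) × I => G (Function.update p.1 i p.2))
      (volume.prod volume) := h.integrable_comp_of_integrable hG
  rw [← integral_prod _ hG']
  conv_lhs => rw [← h.map_eq]
  rw [integral_map h.measurable.aemeasurable]
  rw [h.map_eq]
  exact hG.aestronglyMeasurable

/-! ### Pairings with products of test functions -/

/-- The integral of `G` against the tensor product of the test functions `u i`, `i ∈ S`. Simple
functions are taken as test functions because they are bounded and measurable by definition. -/
noncomputable def pairing {m : ℕ} (G : (Fin m → I) → ℂ) (S : Finset (Fin m))
    (u : Fin m → SimpleFunc I ℝ) : ℂ :=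
  ∫ x, G x * ∏ i ∈ S, (u i (x i) : ℂ)

section Pairing

variable {m : ℕ} {G : (Fin m → I) → ℂ}

lemma measurable_prod_test (S : Finset (Fin m)) (u : Fin m → SimpleFunc I ℝ) :
    Measurable fun x : Fin m → I => ∏ i ∈ S, (u i (x i) : ℂ) :=
  Finset.measurable_fun_prod _ fun i _ =>
    Complex.measurable_ofReal.comp ((u i).measurable.comp (measurable_pi_apply i))

lemma exists_norm_prod_test_le (S : Finset (Fin m)) (u : Fin m → SimpleFunc I ℝ) :
    ∃ C, ∀ x : Fin m → I, ‖∏ i ∈ S, (u i (x i) : ℂ)‖ ≤ C := by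
  choose C hC using fun i => (u i).exists_forall_norm_le
  refine ⟨∏ i ∈ S, C i, fun x => ?_⟩
  rw [norm_prod]
  refine Finset.prod_le_prod (fun _ _ => norm_nonneg _) fun i _ => ?_
  simpa using hC i (x i)

lemma integrable_mul_prod_test (hG : Integrable G volume) (S : Finset (Fin m))
    (u : Fin m → SimpleFunc I ℝ) : Integrable (fun x => G x * ∏ i ∈ S, (u i (x i) : ℂ)) volume := by
  obtain ⟨C, hC⟩ := exists_norm_prod_test_le S u
  exact hG.mul_bdd (c := C) (measurable_prod_test S u).aestronglyMeasurable (.of_forall hC)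

lemma pairing_congr {S : Finset (Fin m)} {u v : Fin m → SimpleFunc I ℝ} (h : ∀ i ∈ S, u i = v i) :
    pairing G S u = pairing G S v := by
  unfold pairing
  congr 1
  ext x
  rw [Finset.prod_congr rfl fun i hi => by rw [h i hi]]

lemma prod_test_update {S : Finset (Fin m)} {i : Fin m} (hi : i ∉ S) (u : Fin m → SimpleFunc I ℝ)
    (x : Fin m → I) (t : I) :
    ∏ j ∈ S, (u j (Function.update x i t j) : ℂ) = ∏ j ∈ S, (u j (x j) : ℂ) :=
  Finset.prod_congr rfl fun j hj => by rw [Function.update_of_ne (ne_of_mem_of_not_mem hj hi)]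

lemma pairing_insert (hG : Integrable G volume) {S : Finset (Fin m)} {i : Fin m} (hi : i ∉ S)
    (h : ∀ x t, G (Function.update x i t) = G x) (u : Fin m → SimpleFunc I ℝ) :
    pairing G (insert i S) u = ((∫ t, u i t : ℝ) : ℂ) * pairing G S u := by
  unfold pairing
  rw [integral_eq_integral_update (integrable_mul_prod_test hG _ u) i, ← integral_const_mul]
  congr 1
  ext x
  rw [← integral_complex_ofReal, ← integral_mul_const]
  congr 1
  ext t
  rw [h, Finset.prod_insert hi, prod_test_update hi, Function.update_self]
  ring

lemma pairing_eq_zero_of_notMem (hG : Integrable G volume) {S : Finset (Fin m)} {i : Fin m}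
    (hi : i ∉ S) (h : ∀ᵐ x : Fin m → I, ∫ t : I, G (Function.update x i t) = 0)
    (u : Fin m → SimpleFunc I ℝ) : pairing G S u = 0 := by
  unfold pairing
  rw [integral_eq_integral_update (integrable_mul_prod_test hG _ u) i]
  refine integral_eq_zero_of_ae ?_
  filter_upwards [h] with x hx
  simp only [prod_test_update hi]
  rw [integral_mul_const, hx, zero_mul, Pi.zero_apply]

lemma pairing_add_const (hG : Integrable G volume) (S : Finset (Fin m))
    {u v : Fin m → SimpleFunc I ℝ} {c : Fin m → ℝ} (h : ∀ i ∈ S, ∀ t, u i t = v i t + c i) :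
    pairing G S u = ∑ T ∈ S.powerset, pairing G T v * ∏ i ∈ S \ T, (c i : ℂ) := by
  unfold pairing
  simp_rw [← integral_mul_const]
  rw [← integral_finsetSum _ fun T _ => (integrable_mul_prod_test hG T v).mul_const _]
  congr 1
  ext x
  rw [Finset.prod_congr rfl fun i hi => by rw [h i hi (x i), Complex.ofReal_add],
    Finset.prod_add, Finset.mul_sum]
  simp only [mul_assoc]

lemma pairing_add_left {G' : (Fin m → I) → ℂ} (hG : Integrable G volume)
    (hG' : Integrable G' volume) (S : Finset (Fin m)) (u : Fin m → SimpleFunc I ℝ) :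
    pairing (fun x => G x + G' x) S u = pairing G S u + pairing G' S u := by
  unfold pairing
  simp only [add_mul]
  exact integral_add (integrable_mul_prod_test hG S u) (integrable_mul_prod_test hG' S u)

lemma pairing_sub_left {G' : (Fin m → I) → ℂ} (hG : Integrable G volume)
    (hG' : Integrable G' volume) (S : Finset (Fin m)) (u : Fin m → SimpleFunc I ℝ) :
    pairing (fun x => G x - G' x) S u = pairing G S u - pairing G' S u := by
  unfold pairing
  simp only [sub_mul]
  exact integral_sub (integrable_mul_prod_test hG S u) (integrable_mul_prod_test hG' S u)

lemma pairing_sum_left {ι : Type*} (s : Finset ι) {H : ι → (Fin m → I) → ℂ}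
    (hH : ∀ k ∈ s, Integrable (H k) volume) (S : Finset (Fin m)) (u : Fin m → SimpleFunc I ℝ) :
    pairing (fun x => ∑ k ∈ s, H k x) S u = ∑ k ∈ s, pairing (H k) S u := by
  unfold pairing
  rw [← integral_finsetSum _ fun k hk => integrable_mul_prod_test (hH k hk) S u]
  simp only [Finset.sum_mul]

lemma pairing_div_left (c : ℂ) (S : Finset (Fin m)) (u : Fin m → SimpleFunc I ℝ) :
    pairing (fun x => G x / c) S u = pairing G S u / c := by
  unfold pairing
  rw [← integral_div]
  congr 1
  ext x
  ring

lemma pairing_congr_ae {G' : (Fin m → I) → ℂ} (h : G =ᵐ[volume] G') (S : Finset (Fin m))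
    (u : Fin m → SimpleFunc I ℝ) : pairing G S u = pairing G' S u := by
  refine integral_congr_ae ?_
  filter_upwards [h] with x hx
  rw [hx]

lemma pairing_update_sum (hG : Integrable G volume) {S : Finset (Fin m)} {l : Fin m} (hl : l ∈ S)
    (u : Fin m → SimpleFunc I ℝ) {ι : Type*} (s : Finset ι) (c : ι → ℝ) (w : ι → SimpleFunc I ℝ)
    {v : SimpleFunc I ℝ} (hv : ∀ t, v t = ∑ j ∈ s, c j * w j t) :
    pairing G S (Function.update u l v) =
      ∑ j ∈ s, (c j : ℂ) * pairing G S (Function.update u l (w j)) := by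
  unfold pairing
  simp_rw [← integral_const_mul]
  rw [← integral_finsetSum _ fun j _ =>
    (integrable_mul_prod_test hG S (Function.update u l (w j))).const_mul _]
  congr 1
  ext x
  have key : ∀ w : SimpleFunc I ℝ, ∏ i ∈ S, (Function.update u l w i (x i) : ℂ) =
      (w (x l) : ℂ) * ∏ i ∈ S.erase l, (u i (x i) : ℂ) := fun w => by
    rw [← Finset.mul_prod_erase _ _ hl, Function.update_self]
    congr 1
    exact Finset.prod_congr rfl fun i hi => by
      rw [Function.update_of_ne (Finset.ne_of_mem_erase hi)]
  simp only [key, hv, Complex.ofReal_sum, Complex.ofReal_mul, Finset.sum_mul, Finset.mul_sum]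
  exact Finset.sum_congr rfl fun j _ => by ring

lemma measurePreserving_comp_perm (τ : Equiv.Perm (Fin m)) :
    MeasurePreserving (fun x : Fin m → I => x ∘ τ) volume volume := by
  convert (volume_measurePreserving_piCongrLeft (fun _ : Fin m => I) τ.symm) using 1
  funext x i
  simpa using (MeasurableEquiv.piCongrLeft_apply_apply (β := fun _ : Fin m => I) τ.symm x (τ i)).symm

lemma pairing_comp_swap (a b : Fin m) (S : Finset (Fin m)) (u : Fin m → SimpleFunc I ℝ) :
    pairing (fun x => G (x ∘ Equiv.swap a b)) S u =
      pairing G (S.map (Equiv.swap a b).toEmbedding) (u ∘ Equiv.swap a b) := by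
  unfold pairing
  have h := measurePreserving_comp_perm (Equiv.swap a b)
  have he : MeasurableEmbedding fun x : Fin m → I => x ∘ Equiv.swap a b :=
    (MeasurableEquiv.mk ⟨fun x : Fin m → I => x ∘ Equiv.swap a b,
      fun x => x ∘ Equiv.swap a b, fun x => by ext; simp, fun x => by ext; simp⟩
      h.measurable h.measurable).measurableEmbedding
  have hinv : ∀ x : Fin m → I, (x ∘ Equiv.swap a b) ∘ Equiv.swap a b = x := fun x => by
    funext j; simp
  rw [← h.integral_comp he]
  simp [hinv]

end Pairing

section WeakLimits

open Filter Topology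

/-! ### Splitting sets without atoms -/

lemma exists_measurableSet_subset_volume_eq {Q : Set I} (hQ : MeasurableSet Q) {c : ENNReal}
    (hc : c ≤ volume Q) : ∃ Q' ⊆ Q, MeasurableSet Q' ∧ volume Q' = c := by
  let g : I → ℝ := fun t => volume.real (Q ∩ Set.Iic t)
  have hg : LipschitzWith 1 g := by
    refine LipschitzWith.of_le_add fun t s => ?_
    rcases le_total t s with hts | hst
    · have h1 : g t ≤ g s := measureReal_mono
        (Set.inter_subset_inter_right _ (Set.Iic_subset_Iic.2 hts))
      linarith [dist_nonneg (x := t) (y := s)]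
    · have hsub : Q ∩ Set.Iic t ⊆ (Q ∩ Set.Iic s) ∪ Set.Ioc s t := fun x hx => by
        rcases le_or_gt x s with h | h
        · exact Or.inl ⟨hx.1, h⟩
        · exact Or.inr ⟨h, hx.2⟩
      have h1 : g t ≤ g s + volume.real (Set.Ioc s t) :=
        (measureReal_mono hsub).trans (measureReal_union_le _ _)
      have h2 : volume.real (Set.Ioc s t) = dist t s := by
        rw [measureReal_def, unitInterval.volume_Ioc, ENNReal.toReal_ofReal, Subtype.dist_eq,
          Real.dist_eq, abs_of_nonneg] <;> simpa using hst
      linarith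
  have hfin : c ≠ ⊤ := ne_top_of_le_ne_top (measure_ne_top _ _) hc
  obtain ⟨t, ht⟩ := mem_range_of_exists_le_of_exists_ge (c := c.toReal) hg.continuous
    ⟨0, by
      have : volume (Q ∩ Set.Iic (0 : I)) = 0 := measure_mono_null Set.inter_subset_right (by
        rw [show Set.Iic (0 : I) = {0} from Set.Iic_bot]; exact measure_singleton _)
      simp [g, measureReal_def, this]⟩
    ⟨1, by
      have : Set.Iic (1 : I) = Set.univ := Set.Iic_top
      simpa [g, measureReal_def, this] using
        (ENNReal.toReal_le_toReal hfin (measure_ne_top _ _)).2 hc⟩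
  refine ⟨Q ∩ Set.Iic t, Set.inter_subset_left, hQ.inter measurableSet_Iic, ?_⟩
  rwa [← ENNReal.toReal_eq_toReal_iff' (measure_ne_top _ _) hfin]

/-- A measurable set can be split into measurable pieces of prescribed measures; the pieces are the
fibres of a measurable labelling. -/
lemma exists_label_volume_eq {ι : Type*} [Nonempty ι] [MeasurableSpace ι]
    [MeasurableSingletonClass ι] [DecidableEq ι] (s : Finset ι) (c : ι → ENNReal) {Q : Set I}
    (hQ : MeasurableSet Q) (hc : ∑ i ∈ s, c i = volume Q) :
    ∃ a : I → ι, Measurable a ∧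
      ∀ i, volume (Q ∩ a ⁻¹' {i}) = if i ∈ s then c i else 0 := by
  induction s using Finset.induction_on generalizing Q with
  | empty =>
    refine ⟨fun _ => Classical.arbitrary ι, measurable_const, fun i => ?_⟩
    simpa using measure_mono_null Set.inter_subset_left hc.symm
  | insert i₀ s hi₀ ih =>
    rw [Finset.sum_insert hi₀] at hc
    obtain ⟨Q', hQ'Q, hQ', hvol⟩ :=
      exists_measurableSet_subset_volume_eq hQ (c := c i₀) (hc ▸ le_self_add)
    have hc' : ∑ i ∈ s, c i = volume (Q \ Q') := by
      rw [measure_sdiff hQ'Q hQ'.nullMeasurableSet (measure_ne_top _ _), ← hc, hvol,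
        ENNReal.add_sub_cancel_left (hvol ▸ measure_ne_top _ _)]
    obtain ⟨a, ha, hav⟩ := ih (hQ.diff hQ') hc'
    classical
    refine ⟨fun x => if x ∈ Q' then i₀ else a x, Measurable.ite hQ' measurable_const ha,
      fun i => ?_⟩
    rcases eq_or_ne i i₀ with rfl | hi
    · have hset : Q ∩ (fun x => if x ∈ Q' then i else a x) ⁻¹' {i} =
          Q' ∪ ((Q \ Q') ∩ a ⁻¹' {i}) := by
        ext x
        by_cases hx : x ∈ Q'
        · simp [hx, hQ'Q hx]
        · simp [hx]
      have hnull : volume ((Q \ Q') ∩ a ⁻¹' {i}) = 0 := by simpa [hi₀] using hav i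
      have hd : Disjoint Q' ((Q \ Q') ∩ a ⁻¹' {i}) :=
        Set.disjoint_left.2 fun x hx hx' => hx'.1.2 hx
      rw [hset, measure_union hd ((hQ.diff hQ').inter (ha (measurableSet_singleton i))), hnull, hvol]
      simp
    · have hset : Q ∩ (fun x => if x ∈ Q' then i₀ else a x) ⁻¹' {i} =
          (Q \ Q') ∩ a ⁻¹' {i} := by
        ext x
        by_cases hx : x ∈ Q'
        · simp [hx, hi.symm]
        · simp [hx]
      rw [hset, hav i]
      simp [hi]

lemma integrable_simpleFunc (w : SimpleFunc I ℝ) : Integrable w volume :=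
  SimpleFunc.integrable_of_isFiniteMeasure w

/-- A fractional partition `h` is matched on finitely many measurable sets by a partition. -/
lemma exists_label_volume_inter_eq {m : ℕ} [NeZero m] {h : Fin m → SimpleFunc I ℝ}
    (h0 : ∀ i t, 0 ≤ h i t) (h1 : ∀ t, ∑ i, h i t = 1) (𝓑 : Finset {B : Set I // MeasurableSet B}) :
    ∃ a : I → Fin m, Measurable a ∧
      ∀ B ∈ 𝓑, ∀ i, volume.real (B.1 ∩ a ⁻¹' {i}) = ∫ t in B.1, h i t := by
  classical
  -- The sets in `𝓑` generate a finite partition, whose cells `Q p` can be split one by one.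
  let τ : I → (𝓑 → Prop) := fun x B => x ∈ B.1.1
  have hτ : Measurable τ := measurable_pi_iff.2 fun B => measurableSet_setOfPred.1 B.1.2
  let Q : (𝓑 → Prop) → Set I := fun p => τ ⁻¹' {p}
  have hQ : ∀ p, MeasurableSet (Q p) := fun p => hτ (measurableSet_singleton p)
  have hsum : ∀ p, ∑ i, ENNReal.ofReal (∫ t in Q p, h i t) = volume (Q p) := fun p => by
    rw [← ENNReal.ofReal_sum_of_nonneg fun i _ => integral_nonneg (h0 i),
      ← integral_finsetSum _ fun i _ => (integrable_simpleFunc (h i)).integrableOn]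
    simp [h1]
  choose a ha hav using fun p => exists_label_volume_eq (Finset.univ : Finset (Fin m)) _ (hQ p)
    (hsum p)
  have hpre : ∀ i, (fun x => a (τ x) x) ⁻¹' {i} = ⋃ p, Q p ∩ a p ⁻¹' {i} := fun i => by
    ext x
    simp [Q]
  refine ⟨fun x => a (τ x) x, measurable_to_countable' fun i => ?_, fun B hB i => ?_⟩
  · rw [hpre]
    exact MeasurableSet.iUnion fun p => (hQ p).inter (ha p (measurableSet_singleton i))
  · let P : Finset (𝓑 → Prop) := Finset.univ.filter fun p => p ⟨B, hB⟩
    have hBQ : B.1 = ⋃ p ∈ P, Q p := by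
      ext x
      simp [P, Q, τ]
    have hBa : B.1 ∩ (fun x => a (τ x) x) ⁻¹' {i} = ⋃ p ∈ P, Q p ∩ a p ⁻¹' {i} := by
      ext x
      simp [P, Q, τ]
    have hd : Pairwise (Function.onFun Disjoint Q) := fun p q hpq =>
      Set.disjoint_left.2 fun x hx hx' => hpq (hx.symm.trans hx')
    rw [hBa, measureReal_biUnion_finset
      (fun p _ q _ hpq => (hd hpq).mono Set.inter_subset_left Set.inter_subset_left)
      (fun p _ => (hQ p).inter (ha p (measurableSet_singleton i)))]
    rw [hBQ, integral_biUnion_finset P (fun p _ => hQ p) (fun p _ q _ hpq => hd hpq)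
      (fun p _ => (integrable_simpleFunc (h i)).integrableOn)]
    refine Finset.sum_congr rfl fun p _ => ?_
    rw [measureReal_def, hav p i, if_pos (Finset.mem_univ i),
      ENNReal.toReal_ofReal (integral_nonneg (h0 i))]

/-! ### Fractional partitions as weak limits of partitions -/

lemma setIntegral_pi_prod_test {m : ℕ} (B : Fin m → Set I) (hB : ∀ i, MeasurableSet (B i))
    (u : Fin m → SimpleFunc I ℝ) :
    ∫ x in Set.univ.pi B, ∏ i, (u i (x i) : ℂ) = ∏ i, ((∫ t in B i, u i t : ℝ) : ℂ) := by
  rw [← integral_indicator (MeasurableSet.univ_pi hB)]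
  have : (Set.univ.pi B).indicator (fun x : Fin m → I => ∏ i, (u i (x i) : ℂ)) =
      fun x => ∏ i, (B i).indicator (fun t => (u i t : ℂ)) (x i) := by
    ext x
    by_cases hx : x ∈ Set.univ.pi B
    · rw [Set.indicator_of_mem hx]
      exact Finset.prod_congr rfl fun i _ => by rw [Set.indicator_of_mem (hx i trivial)]
    · rw [Set.indicator_of_notMem hx]
      obtain ⟨i, hi⟩ : ∃ i, x i ∉ B i := by simpa [Set.mem_pi] using hx
      exact (Finset.prod_eq_zero (Finset.mem_univ i) (Set.indicator_of_notMem hi _)).symm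
  rw [this, integral_fintype_prod_volume_eq_prod (fun i t => (B i).indicator
    (fun t => (u i t : ℂ)) t)]
  refine Finset.prod_congr rfl fun i _ => ?_
  rw [integral_indicator (hB i), integral_complex_ofReal]

lemma norm_prod_test_le_one {m : ℕ} {u : Fin m → SimpleFunc I ℝ} (hu : ∀ i t, |u i t| ≤ 1)
    (x : Fin m → I) : ‖∏ i, (u i (x i) : ℂ)‖ ≤ 1 := by
  rw [norm_prod]
  exact Finset.prod_le_one (fun _ _ => norm_nonneg _) fun i _ => by simpa using hu i (x i)

lemma integrable_prod_test {m : ℕ} (S : Finset (Fin m)) (u : Fin m → SimpleFunc I ℝ) :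
    Integrable (fun x : Fin m → I => ∏ i ∈ S, (u i (x i) : ℂ)) volume := by
  simpa using integrable_mul_prod_test (integrable_const (1 : ℂ)) S u

/-- One-variable weak convergence of the factors gives convergence of the integrals of the product
over boxes, and then, by a π-λ argument, over all measurable subsets of the cube. -/
lemma tendsto_setIntegral_prod_test {m : ℕ} {κ : Type*} {L : Filter κ}
    {u : κ → Fin m → SimpleFunc I ℝ} {h : Fin m → SimpleFunc I ℝ} (hu : ∀ k i t, |u k i t| ≤ 1)
    (H : ∀ B, MeasurableSet B → ∀ i,
      Tendsto (fun k => ∫ t in B, u k i t) L (𝓝 (∫ t in B, h i t)))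
    {s : Set (Fin m → I)} (hs : MeasurableSet s) :
    Tendsto (fun k => ∫ x in s, ∏ i, (u k i (x i) : ℂ)) L
      (𝓝 (∫ x in s, ∏ i, (h i (x i) : ℂ))) := by
  have hbox : ∀ B : Fin m → Set I, (∀ i, MeasurableSet (B i)) →
      Tendsto (fun k => ∫ x in Set.univ.pi B, ∏ i, (u k i (x i) : ℂ)) L
      (𝓝 (∫ x in Set.univ.pi B, ∏ i, (h i (x i) : ℂ))) := fun B hB => by
    simp_rw [setIntegral_pi_prod_test B hB]
    exact tendsto_finsetProd _ fun i _ =>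
      (Complex.continuous_ofReal.tendsto _).comp (H (B i) (hB i) i)
  refine MeasurableSpace.induction_on_inter (C := fun s _ => Tendsto (fun k =>
    ∫ x in s, ∏ i, (u k i (x i) : ℂ)) L (𝓝 (∫ x in s, ∏ i, (h i (x i) : ℂ))))
    generateFrom_pi.symm isPiSystem_pi ?_ ?_ ?_ ?_ s hs
  · simpa using tendsto_const_nhds
  · rintro _ ⟨B, hB, rfl⟩
    exact hbox B fun i => hB i trivial
  · intro t ht iht
    have huniv := hbox (fun _ => Set.univ) fun _ => MeasurableSet.univ
    rw [Set.pi_univ] at huniv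
    simp_rw [setIntegral_compl ht (integrable_prod_test _ _)]
    simpa using huniv.sub iht
  · intro g hd hg ih
    simp_rw [integral_iUnion hg hd (integrable_prod_test _ _).integrableOn]
    refine tendsto_tsum_of_dominated_convergence (bound := fun n => volume.real (g n)) ?_ ih
      (.of_forall fun k n => ?_)
    · have := (hasSum_integral_iUnion (μ := volume) (f := fun _ => (1 : ℝ)) hg hd
        (integrable_const (1 : ℝ)).integrableOn).summable
      simpa using this
    · simpa using norm_setIntegral_le_of_norm_le_const (measure_lt_top _ _)
        fun x _ => norm_prod_test_le_one (hu k) x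

lemma norm_pairing_sub_le {m : ℕ} {f g : (Fin m → I) → ℂ} (hf : Integrable f volume)
    (hg : Integrable g volume) {u : Fin m → SimpleFunc I ℝ} (hu : ∀ i t, |u i t| ≤ 1) :
    ‖pairing f Finset.univ u - pairing g Finset.univ u‖ ≤ ∫ x, ‖f x - g x‖ := by
  rw [← pairing_sub_left hf hg]
  refine norm_integral_le_of_norm_le (hf.sub hg).norm (.of_forall fun x => ?_)
  rw [norm_mul]
  exact mul_le_of_le_one_right (norm_nonneg _) (norm_prod_test_le_one hu x)

/-- Weak-* convergence of uniformly bounded one-variable functions passes to tensor products, tested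
against an integrable function of several variables. -/
lemma tendsto_pairing {m : ℕ} {κ : Type*} {L : Filter κ}
    {u : κ → Fin m → SimpleFunc I ℝ} {h : Fin m → SimpleFunc I ℝ} (hu : ∀ k i t, |u k i t| ≤ 1)
    (hh : ∀ i t, |h i t| ≤ 1)
    (H : ∀ B, MeasurableSet B → ∀ i,
      Tendsto (fun k => ∫ t in B, u k i t) L (𝓝 (∫ t in B, h i t)))
    {f : (Fin m → I) → ℂ} (hf : Integrable f volume) :
    Tendsto (fun k => pairing f Finset.univ (u k)) L (𝓝 (pairing f Finset.univ h)) := by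
  refine Integrable.induction (P := fun f => Tendsto (fun k => pairing f Finset.univ (u k)) L
    (𝓝 (pairing f Finset.univ h))) ?_ ?_ ?_ ?_ hf
  · intro c s hs _
    have key : ∀ v : Fin m → SimpleFunc I ℝ, pairing (s.indicator fun _ => c) Finset.univ v =
        c * ∫ x in s, ∏ i, (v i (x i) : ℂ) := fun v => by
      rw [pairing, ← integral_indicator hs, ← integral_const_mul]
      congr 1
      ext x
      by_cases hx : x ∈ s <;> simp [hx]
    simp_rw [key]
    exact (tendsto_setIntegral_prod_test hu H hs).const_mul c
  · intro f g _ hf hg ihf ihg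
    have key := fun v => pairing_add_left hf hg Finset.univ v
    simp only [show f + g = fun x => f x + g x from rfl, key]
    exact ihf.add ihg
  · refine isClosed_of_closure_subset fun f hf => ?_
    rw [Set.mem_ofPred_eq, Metric.tendsto_nhds]
    intro ε hε
    obtain ⟨g, hg, hfg⟩ := Metric.mem_closure_iff.1 hf (ε / 3) (by positivity)
    have hd : ∫ x, ‖f x - g x‖ < ε / 3 := by
      rw [dist_eq_norm, L1.norm_eq_integral_norm] at hfg
      refine lt_of_eq_of_lt (integral_congr_ae ?_) hfg
      filter_upwards [Lp.coeFn_sub f g] with x hx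
      rw [hx, Pi.sub_apply]
    have hb := fun v hv => norm_pairing_sub_le (u := v) (L1.integrable_coeFn f)
      (L1.integrable_coeFn g) hv
    filter_upwards [Metric.tendsto_nhds.1 hg (ε / 3) (by positivity)] with k hk
    have h1 := hb (u k) (hu k)
    have h2 := hb h hh
    rw [← dist_eq_norm] at h1 h2
    rw [dist_comm] at h2
    linarith [dist_triangle4 (pairing f Finset.univ (u k)) (pairing g Finset.univ (u k))
      (pairing g Finset.univ h) (pairing f Finset.univ h)]
  · intro f g hfg _ ihf
    have key := fun v => pairing_congr_ae hfg Finset.univ v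
    simpa only [key] using ihf

/-- The indicator function of a measurable set, as a test function. -/
noncomputable def indicatorTest (A : Set I) (hA : MeasurableSet A) : SimpleFunc I ℝ :=
  SimpleFunc.piecewise A hA (SimpleFunc.const I 1) (SimpleFunc.const I 0)

lemma indicatorTest_apply {A : Set I} (hA : MeasurableSet A) (t : I) :
    indicatorTest A hA t = A.indicator 1 t := by
  classical
  simp [indicatorTest, Set.indicator_apply, Set.piecewise]

lemma setIntegral_indicatorTest {A : Set I} (hA : MeasurableSet A) (B : Set I) :
    ∫ t in B, indicatorTest A hA t = volume.real (B ∩ A) := by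
  simp_rw [indicatorTest_apply, integral_indicator_one hA]
  rw [measureReal_restrict_apply hA, Set.inter_comm]

lemma integral_indicatorTest {A : Set I} (hA : MeasurableSet A) :
    ∫ t, indicatorTest A hA t = volume.real A := by
  simpa using setIntegral_indicatorTest hA Set.univ

lemma pairing_indicatorTest {m : ℕ} (f : (Fin m → I) → ℂ) {A : Fin m → Set I}
    (hA : ∀ i, MeasurableSet (A i)) :
    pairing f Finset.univ (fun i => indicatorTest (A i) (hA i)) = ∫ x in Set.univ.pi A, f x := by
  rw [pairing, ← integral_indicator (MeasurableSet.univ_pi hA)]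
  congr 1
  ext x
  simp only [indicatorTest_apply]
  by_cases hx : x ∈ Set.univ.pi A
  · rw [Set.indicator_of_mem hx, Finset.prod_congr rfl fun i _ => by
      rw [Set.indicator_of_mem (hx i trivial)]]
    simp
  · rw [Set.indicator_of_notMem hx]
    obtain ⟨i, hi⟩ : ∃ i, x i ∉ A i := by simpa [Set.mem_pi] using hx
    rw [Finset.prod_eq_zero (Finset.mem_univ i) (by rw [Set.indicator_of_notMem hi]; simp),
      mul_zero]

/-- If the integrals of `f` over all partitions of type `α` vanish, then so do those over
fractional partitions: these are weak-* limits of partitions. -/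
lemma pairing_eq_zero_of_fractional {m : ℕ} {α : Fin m → ℝ} {f : (Fin m → I) → ℂ}
    (hf : Integrable f volume)
    (hA : ∀ A : Fin m → Set I, IsMeasurePartition α A → ∫ x in Set.univ.pi A, f x = 0)
    {h : Fin m → SimpleFunc I ℝ} (h0 : ∀ i t, 0 ≤ h i t) (h1 : ∀ t, ∑ i, h i t = 1)
    (hα : ∀ i, ∫ t, h i t = α i) : pairing f Finset.univ h = 0 := by
  have : NeZero m := ⟨by rintro rfl; simpa using h1 0⟩
  choose a ha hav using exists_label_volume_inter_eq h0 h1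
  have hm : ∀ k i, MeasurableSet (a k ⁻¹' {i}) := fun k i => ha k (measurableSet_singleton i)
  have hlim : Tendsto (fun k => pairing f Finset.univ fun i => indicatorTest (a k ⁻¹' {i}) (hm k i))
      atTop (𝓝 (pairing f Finset.univ h)) := by
    refine tendsto_pairing (fun k i t => ?_) (fun i t => ?_) (fun B hB i => ?_) hf
    · rw [indicatorTest_apply]
      by_cases ht : t ∈ a k ⁻¹' {i}
      · simp [Set.indicator_of_mem ht]
      · simp [Set.indicator_of_notMem ht]
    · rw [abs_of_nonneg (h0 i t), ← h1 t]
      exact Finset.single_le_sum (fun j _ => h0 j t) (Finset.mem_univ i)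
    · refine tendsto_const_nhds.congr' ?_
      filter_upwards [eventually_ge_atTop {⟨B, hB⟩}] with k hk
      rw [setIntegral_indicatorTest, hav k ⟨B, hB⟩ (hk (Finset.mem_singleton_self _))]
  refine tendsto_nhds_unique hlim (tendsto_const_nhds.congr' ?_)
  filter_upwards [eventually_ge_atTop {⟨Set.univ, MeasurableSet.univ⟩}] with k hk
  rw [pairing_indicatorTest, hA]
  refine ⟨hm k, fun i j hij => Set.disjoint_left.2 fun x hx hx' => hij (hx.symm.trans hx'), ?_,
    fun i => ?_⟩
  · ext x
    simp
  · have := hav k ⟨Set.univ, MeasurableSet.univ⟩ (hk (Finset.mem_singleton_self _)) i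
    rw [Set.univ_inter, setIntegral_univ, hα] at this
    rw [← this, ofReal_measureReal]

/-! ### Pairings of the Walsh components -/

section NormPairing

variable {m : ℕ} {α : Fin m → ℝ} {f : (Fin m → I) → ℂ} {F : Finset (Fin m) → (Fin m → I) → ℂ}

lemma simpleFunc_sum_apply {ι : Type*} (s : Finset ι) (u : ι → SimpleFunc I ℝ) (t : I) :
    (∑ i ∈ s, u i) t = ∑ i ∈ s, u i t := by
  classical
  induction s using Finset.induction_on with
  | empty => simp
  | insert i s hi ih => rw [Finset.sum_insert hi, Finset.sum_insert hi, SimpleFunc.add_apply, ih]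

lemma pairing_eq_zero_of_test_eq_zero {G : (Fin m → I) → ℂ} {S : Finset (Fin m)}
    {u : Fin m → SimpleFunc I ℝ} {i : Fin m} (hi : i ∈ S) (hu : u i = 0) : pairing G S u = 0 := by
  have h : ∀ x : Fin m → I, ∏ j ∈ S, (u j (x j) : ℂ) = 0 := fun x =>
    Finset.prod_eq_zero hi (by simp [hu])
  simp [pairing, h]

lemma IsWalshExpansion.update_eq (hF : IsWalshExpansion f F) {S : Finset (Fin m)} {i : Fin m}
    (hi : i ∉ S) (x : Fin m → I) (t : I) : F S (Function.update x i t) = F S x :=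
  hF.dependsOn S fun _ hj => Function.update_of_ne (ne_of_mem_of_not_mem hj hi) _ _

lemma IsWalshExpansion.pairing_eq_zero_of_not_subset (hF : IsWalshExpansion f F)
    {S T : Finset (Fin m)} (hST : ¬ S ⊆ T) (u : Fin m → SimpleFunc I ℝ) :
    pairing (F S) T u = 0 := by
  obtain ⟨i, hiS, hiT⟩ := Finset.not_subset.1 hST
  exact pairing_eq_zero_of_notMem (hF.integrable S) hiT (hF.integral_eq_zero S i hiS) u

/-- Orthogonality of the Walsh components to products of centred functions of other coordinates. -/
lemma IsWalshExpansion.pairing_eq_zero_of_ne (hF : IsWalshExpansion f F) {S T : Finset (Fin m)}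
    (hST : S ≠ T) {v : Fin m → SimpleFunc I ℝ} (hv : ∀ i, ∫ t, v i t = 0) :
    pairing (F S) T v = 0 := by
  by_cases h : S ⊆ T
  · obtain ⟨i, hiT, hiS⟩ := Finset.exists_of_ssubset (h.ssubset_of_ne hST)
    rw [← Finset.insert_erase hiT, pairing_insert (hF.integrable S) (Finset.notMem_erase i T)
      (hF.update_eq hiS), hv]
    simp
  · exact hF.pairing_eq_zero_of_not_subset h v

/-- The pairing of the normalized component `F S / ∏ i ∈ S, α i` with test functions. -/
noncomputable def normPairing (α : Fin m → ℝ) (F : Finset (Fin m) → (Fin m → I) → ℂ)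
    (S : Finset (Fin m)) (u : Fin m → SimpleFunc I ℝ) : ℂ :=
  pairing (F S) S u / ((∏ i ∈ S, α i : ℝ) : ℂ)

lemma normPairing_congr {S : Finset (Fin m)} {u v : Fin m → SimpleFunc I ℝ}
    (h : ∀ i ∈ S, u i = v i) : normPairing α F S u = normPairing α F S v := by
  rw [normPairing, normPairing, pairing_congr h]

lemma normPairing_eq_zero_of_test_eq_zero {S : Finset (Fin m)}
    {u : Fin m → SimpleFunc I ℝ} {i : Fin m} (hi : i ∈ S) (hu : u i = 0) :
    normPairing α F S u = 0 := by
  rw [normPairing, pairing_eq_zero_of_test_eq_zero hi hu, zero_div]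

lemma normPairing_update_sum (hF : IsWalshExpansion f F) {S : Finset (Fin m)} {l : Fin m}
    (hl : l ∈ S) (u : Fin m → SimpleFunc I ℝ) {ι : Type*} (s : Finset ι) (c : ι → ℝ)
    (w : ι → SimpleFunc I ℝ) {v : SimpleFunc I ℝ} (hv : ∀ t, v t = ∑ j ∈ s, c j * w j t) :
    normPairing α F S (Function.update u l v) =
      ∑ j ∈ s, (c j : ℂ) * normPairing α F S (Function.update u l (w j)) := by
  simp only [normPairing]
  rw [pairing_update_sum (hF.integrable S) hl u s c w hv, Finset.sum_div]
  exact Finset.sum_congr rfl fun _ _ => by ring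

lemma normPairing_update_neg_sum (hF : IsWalshExpansion f F) {S : Finset (Fin m)} {l : Fin m}
    (hl : l ∈ S) (u : Fin m → SimpleFunc I ℝ) {ι : Type*} (s : Finset ι)
    (w : ι → SimpleFunc I ℝ) :
    normPairing α F S (Function.update u l (-∑ j ∈ s, w j)) =
      -∑ j ∈ s, normPairing α F S (Function.update u l (w j)) := by
  rw [normPairing_update_sum hF hl u s (fun _ => -1) w fun t => by
    simp [SimpleFunc.neg_apply, simpleFunc_sum_apply]]
  simp

lemma normPairing_update_neg (hF : IsWalshExpansion f F) {S : Finset (Fin m)} {l : Fin m}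
    (hl : l ∈ S) (u : Fin m → SimpleFunc I ℝ) (w : SimpleFunc I ℝ) :
    normPairing α F S (Function.update u l (-w)) =
      -normPairing α F S (Function.update u l w) := by
  simpa using normPairing_update_neg_sum hF hl u ({()} : Finset Unit) fun _ => w

lemma normPairing_update_add (hF : IsWalshExpansion f F) {S : Finset (Fin m)} {l : Fin m}
    (hl : l ∈ S) (u : Fin m → SimpleFunc I ℝ) (w w' : SimpleFunc I ℝ) :
    normPairing α F S (Function.update u l (w + w')) =
      normPairing α F S (Function.update u l w) + normPairing α F S (Function.update u l w') := by
  simpa using normPairing_update_sum hF hl u (Finset.univ : Finset (Fin 2)) (fun _ => 1) ![w, w']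
    fun t => by simp

lemma normPairing_smul (S : Finset (Fin m)) (u v : Fin m → SimpleFunc I ℝ) {c : ℝ}
    (h : ∀ i t, v i t = c * u i t) :
    normPairing α F S v = (c : ℂ) ^ S.card * normPairing α F S u := by
  simp only [normPairing, pairing]
  rw [← mul_div_assoc, ← integral_const_mul]
  congr 2
  ext x
  simp only [h, Complex.ofReal_mul, Finset.prod_mul_distrib, Finset.prod_const]
  ring

/-- Adding constants to the test functions does not matter, since the Walsh component `F S` has
vanishing marginals. -/
lemma normPairing_add_const (hF : IsWalshExpansion f F) (S : Finset (Fin m))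
    {u v : Fin m → SimpleFunc I ℝ} {c : Fin m → ℝ} (h : ∀ i t, u i t = v i t + c i) :
    normPairing α F S u = normPairing α F S v := by
  rw [normPairing, normPairing, pairing_add_const (hF.integrable S) S fun i _ => h i,
    Finset.sum_eq_single S]
  · simp
  · intro T hT hTS
    rw [hF.pairing_eq_zero_of_not_subset fun h =>
      hTS ((Finset.mem_powerset.1 hT).antisymm h), zero_mul]
  · simp

/-- The integral of `f` against a perturbation of the constants `α` by centred functions, as a sum
over the Walsh components. -/
lemma pairing_add_const_eq_sum (hF : IsWalshExpansion f F) (hα : ∀ i, α i ≠ 0)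
    {u v : Fin m → SimpleFunc I ℝ} (h : ∀ i t, u i t = v i t + α i) (hv : ∀ i, ∫ t, v i t = 0) :
    pairing f Finset.univ u = ((∏ i, α i : ℝ) : ℂ) * ∑ S, normPairing α F S v := by
  rw [pairing_congr_ae hF.sum_eq, pairing_sum_left _ fun S _ => hF.integrable S, Finset.mul_sum]
  refine Finset.sum_congr rfl fun S _ => ?_
  rw [pairing_add_const (hF.integrable S) _ fun i _ => h i, Finset.sum_eq_single S, normPairing,
    ← Finset.prod_sdiff (Finset.subset_univ S)]
  · have : ((∏ i ∈ S, α i : ℝ) : ℂ) ≠ 0 :=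
      Complex.ofReal_ne_zero.2 (Finset.prod_ne_zero_iff.2 fun i _ => hα i)
    field_simp
    push_cast
    ring
  · intro T _ hTS
    rw [hF.pairing_eq_zero_of_ne hTS.symm hv, zero_mul]
  · simp

/-- The multilinear content of the hypothesis: the part of degree `k` in the perturbation
vanishes. -/
lemma sum_normPairing_powersetCard_eq_zero (hα : ∀ i, 0 < α i) (hsum : ∑ i, α i = 1)
    (hf : Integrable f volume) (hF : IsWalshExpansion f F)
    (hA : ∀ A : Fin m → Set I, IsMeasurePartition α A → ∫ x in Set.univ.pi A, f x = 0)
    {u : Fin m → SimpleFunc I ℝ} (hu : ∑ i, u i = 0) (k : ℕ) :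
    ∑ S ∈ Finset.powersetCard k Finset.univ, normPairing α F S u = 0 := by
  have hut : ∀ t, ∑ i, u i t = 0 := fun t => by rw [← simpleFunc_sum_apply, hu]; simp
  let v : Fin m → SimpleFunc I ℝ := fun i => u i - SimpleFunc.const I (∫ t, u i t)
  have hvapp : ∀ i t, v i t = u i t - ∫ t, u i t := fun i t => by simp [v]
  have hv0 : ∀ i, ∫ t, v i t = 0 := fun i => by
    simp_rw [hvapp]
    rw [integral_sub (integrable_simpleFunc _) (integrable_const _)]
    simp
  have hvsum : ∀ t, ∑ i, v i t = 0 := fun t => by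
    simp_rw [hvapp, Finset.sum_sub_distrib]
    rw [← integral_finsetSum _ fun i _ => integrable_simpleFunc (u i)]
    simp [hut]
  rw [Finset.sum_congr rfl fun S _ => normPairing_add_const hF S (u := u) (v := v)
    (c := fun i => ∫ t, u i t) fun i t => by rw [hvapp]; ring]
  choose C hC using fun i => (v i).exists_forall_norm_le
  -- For small `ε > 0` the functions `α i + ε v i` form a fractional partition.
  have hsmall : ∀ᶠ ε in 𝓝[>] (0 : ℝ), ∀ i, ε * C i ≤ α i := by
    refine eventually_all.2 fun i => ?_
    have : Tendsto (fun ε : ℝ => ε * C i) (𝓝[>] 0) (𝓝 (0 * C i)) :=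
      (continuous_mul_const (C i)).continuousAt.tendsto.mono_left nhdsWithin_le_nhds
    rw [zero_mul] at this
    exact (this.eventually (gt_mem_nhds (hα i))).mono fun _ h => h.le
  have hzero : ∀ᶠ ε : ℝ in 𝓝[>] (0 : ℝ),
      ∑ S : Finset (Fin m), normPairing α F S v * (ε : ℂ) ^ S.card = 0 := by
    filter_upwards [hsmall, self_mem_nhdsWithin] with ε hε hε0
    have hε0 : 0 < ε := hε0
    have happ : ∀ i t, (ε • v i + SimpleFunc.const I (α i)) t = ε * v i t + α i := fun i t => by
      simp
    have h1 := pairing_eq_zero_of_fractional (α := α) hf hA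
      (h := fun i => ε • v i + SimpleFunc.const I (α i)) (fun i t => ?_) (fun t => ?_) (fun i => ?_)
    · rw [pairing_add_const_eq_sum hF (fun i => (hα i).ne') (v := fun i => ε • v i)
        (fun i t => by simp) (fun i => by
          simp only [SimpleFunc.smul_apply, smul_eq_mul]
          rw [integral_const_mul, hv0, mul_zero])] at h1
      have h2 := (mul_eq_zero.1 h1).resolve_left
        (Complex.ofReal_ne_zero.2 (Finset.prod_ne_zero_iff.2 fun i _ => (hα i).ne'))
      rw [← h2]
      refine Finset.sum_congr rfl fun S _ => ?_
      rw [normPairing_smul S v (fun i => ε • v i) (c := ε) (fun i t => by simp), mul_comm]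
    · rw [happ]
      have := neg_le_of_abs_le (hC i t)
      nlinarith [hε i]
    · simp only [happ]
      rw [Finset.sum_add_distrib, ← Finset.mul_sum, hvsum, hsum]
      simp
    · simp only [happ]
      rw [integral_add ((integrable_simpleFunc _).const_mul _) (integrable_const _),
        integral_const_mul, hv0]
      simp
  let p : Polynomial ℂ :=
    ∑ S : Finset (Fin m), Polynomial.C (normPairing α F S v) * Polynomial.X ^ S.card
  have hp : p = 0 := by
    refine Polynomial.eq_zero_of_infinite_isRoot p ?_
    have hinf : Set.Infinite {ε : ℝ | ∑ S : Finset (Fin m),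
        normPairing α F S v * (ε : ℂ) ^ S.card = 0} := by
      obtain ⟨a, ha, hsub⟩ := mem_nhdsGT_iff_exists_Ioo_subset.1 hzero
      exact (Set.Ioo_infinite ha).mono hsub
    refine (hinf.image Complex.ofReal_injective.injOn).mono ?_
    rintro _ ⟨ε, hε, rfl⟩
    simpa [p, Polynomial.IsRoot, Polynomial.eval_finsetSum] using hε
  have hcoeff := congrArg (fun q => Polynomial.coeff q k) hp
  simp only [p, Polynomial.finsetSum_coeff, Polynomial.coeff_C_mul, Polynomial.coeff_X_pow,
    Polynomial.coeff_zero, mul_ite, mul_one, mul_zero] at hcoeff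
  rw [← Finset.sum_filter] at hcoeff
  rw [← hcoeff]
  refine Finset.sum_congr ?_ fun _ _ => rfl
  ext S
  simp [Finset.mem_powersetCard, eq_comm]

end NormPairing

end WeakLimits

/-! ### Separation by products of test functions -/

lemma ae_eq_zero_of_pairing_univ_eq_zero {m : ℕ} {H : (Fin m → I) → ℂ}
    (hH : Integrable H volume) (h : ∀ u, pairing H Finset.univ u = 0) : H =ᵐ[volume] 0 := by
  have hbox : ∀ B : Fin m → Set I, (∀ i, MeasurableSet (B i)) →
      ∫ x in Set.univ.pi B, H x = 0 := fun B hB => by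
    rw [← pairing_indicatorTest H hB, h]
  refine hH.ae_eq_zero_of_forall_setIntegral_eq_zero fun s hs _ => ?_
  refine MeasurableSpace.induction_on_inter (C := fun s _ => ∫ x in s, H x = 0)
    generateFrom_pi.symm isPiSystem_pi ?_ ?_ ?_ ?_ s hs
  · simp
  · rintro _ ⟨B, hB, rfl⟩
    exact hbox B fun i => hB i trivial
  · intro t ht iht
    have huniv := hbox (fun _ => Set.univ) fun _ => MeasurableSet.univ
    rw [Set.pi_univ, setIntegral_univ] at huniv
    rw [setIntegral_compl ht hH, huniv, iht, sub_zero]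
  · intro g hd hg ih
    rw [integral_iUnion hg hd hH.integrableOn]
    simp [ih]

/-- A function of the coordinates in `T` is determined by its pairings with products of functions
of these coordinates. -/
lemma ae_eq_zero_of_pairing_eq_zero {m : ℕ} {H : (Fin m → I) → ℂ} (hH : Integrable H volume)
    {T : Finset (Fin m)} (hT : ∀ i ∉ T, ∀ x t, H (Function.update x i t) = H x)
    (h : ∀ u, pairing H T u = 0) : H =ᵐ[volume] 0 := by
  refine ae_eq_zero_of_pairing_univ_eq_zero hH fun u => ?_
  have key : ∀ R : Finset (Fin m), pairing H (T ∪ R) u = 0 := fun R => by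
    induction R using Finset.induction_on with
    | empty => simpa using h u
    | insert i R _ ih =>
      rw [Finset.union_insert]
      by_cases hi : i ∈ T ∪ R
      · rwa [Finset.insert_eq_of_mem hi]
      · rw [pairing_insert hH hi (hT i fun hiT => hi (Finset.mem_union_left _ hiT)), ih, mul_zero]
  simpa only [Finset.union_eq_right.2 (Finset.subset_univ T)] using key Finset.univ

/-! ### The conditions in weak form -/

section Conditions

variable {m : ℕ} {α : Fin m → ℝ} {f : (Fin m → I) → ℂ} {F : Finset (Fin m) → (Fin m → I) → ℂ}

lemma integrable_comp_swap {G : (Fin m → I) → ℂ} (hG : Integrable G volume) (a b : Fin m) :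
    Integrable (fun x => G (x ∘ Equiv.swap a b)) volume :=
  (measurePreserving_comp_perm (Equiv.swap a b)).integrable_comp_of_integrable hG

lemma comp_swap_eq_update (u : Fin m → SimpleFunc I ℝ) (a b : Fin m) :
    u ∘ Equiv.swap a b = Function.update (Function.update u a (u b)) b (u a) := by
  funext i
  simp only [Function.comp_apply, Function.update_apply, Equiv.swap_apply_def]
  split_ifs <;> simp_all

lemma map_swap_eq_self {S : Finset (Fin m)} {a b : Fin m} (ha : a ∈ S) (hb : b ∈ S) :
    S.map (Equiv.swap a b).toEmbedding = S := by
  refine Finset.eq_of_subset_of_card_le (fun i hi => ?_) (by simp)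
  obtain ⟨j, hj, rfl⟩ := Finset.mem_map.1 hi
  simp only [Equiv.coe_toEmbedding, Equiv.swap_apply_def]
  split_ifs <;> assumption

lemma map_swap_eq_union_sdiff {S : Finset (Fin m)} {l i : Fin m} (hl : l ∉ S) (hi : i ∈ S) :
    S.map (Equiv.swap l i).toEmbedding = (S ∪ {l}) \ {i} := by
  have hli : l ≠ i := fun h => hl (h ▸ hi)
  refine Finset.eq_of_subset_of_card_le (fun k hk => ?_) ?_
  · obtain ⟨j, hj, rfl⟩ := Finset.mem_map.1 hk
    have hjl : j ≠ l := fun h => hl (h ▸ hj)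
    simp only [Equiv.coe_toEmbedding, Equiv.swap_apply_def, if_neg hjl]
    split_ifs with hji
    · simp [hli]
    · simp [hj, hji]
  · rw [Finset.card_map, Finset.card_sdiff_of_subset (by simp [hi]),
      Finset.card_union_of_disjoint (by simpa using hl)]
    simp

/-- Condition (ii) in weak form: antisymmetry means that the pairing vanishes as soon as two test
functions coincide. -/
lemma isAlternatingOn_iff_normPairing_eq_zero (hα : ∀ i, α i ≠ 0) (hF : IsWalshExpansion f F)
    (S : Finset (Fin m)) :
    IsAlternatingOn (F S) S ↔ ∀ i ∈ S, ∀ j ∈ S, i ≠ j → ∀ u : Fin m → SimpleFunc I ℝ,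
      u i = u j → normPairing α F S u = 0 := by
  have hprod : ((∏ i ∈ S, α i : ℝ) : ℂ) ≠ 0 :=
    Complex.ofReal_ne_zero.2 (Finset.prod_ne_zero_iff.2 fun i _ => hα i)
  refine forall₂_congr fun i hi => forall₂_congr fun j hj => forall_congr' fun hij => ?_
  have hswap : ∀ u, pairing (fun x => F S (x ∘ Equiv.swap i j)) S u =
      pairing (F S) S (u ∘ Equiv.swap i j) := fun u => by
    rw [pairing_comp_swap, map_swap_eq_self hi hj]
  constructor
  · intro h u hu
    have h0 : pairing (fun x => F S (x ∘ Equiv.swap i j) + F S x) S u = 0 := by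
      rw [pairing_congr_ae (G' := 0) (by filter_upwards [h] with x hx; simp [hx])]
      simp [pairing]
    rw [pairing_add_left (integrable_comp_swap (hF.integrable S) i j) (hF.integrable S), hswap,
      comp_swap_eq_update, ← hu, Function.update_eq_self, hu, Function.update_eq_self] at h0
    rw [normPairing, add_self_eq_zero.1 h0, zero_div]
  · intro h
    have hzero := ae_eq_zero_of_pairing_eq_zero (T := S)
      (H := fun x => F S (x ∘ Equiv.swap i j) + F S x)
      ((integrable_comp_swap (hF.integrable S) i j).add (hF.integrable S)) (fun k hk x t => ?_)
      fun u => ?_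
    · filter_upwards [hzero] with x hx
      exact eq_neg_of_add_eq_zero_left hx
    · congr 1
      · refine hF.dependsOn S fun r hr => ?_
        have : Equiv.swap i j r ∈ S := by
          rw [← map_swap_eq_self hi hj]
          exact Finset.mem_map_of_mem _ hr
        exact Function.update_of_ne (ne_of_mem_of_not_mem this hk) _ _
      · exact hF.update_eq hk x t
    · -- Polarization of the vanishing on the diagonal.
      let P : SimpleFunc I ℝ → SimpleFunc I ℝ → ℂ := fun a b =>
        normPairing α F S (Function.update (Function.update u i a) j b)
      have hP : ∀ a, P a a = 0 := fun a => h _ (by simp [hij])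
      have hadd₂ : ∀ a b c, P a (b + c) = P a b + P a c := fun a b c =>
        normPairing_update_add hF hj _ _ _
      have hadd₁ : ∀ a b c, P (a + b) c = P a c + P b c := fun a b c => by
        simp only [P, Function.update_comm hij]
        exact normPairing_update_add hF hi _ _ _
      have key : P (u j) (u i) + P (u i) (u j) = 0 := by
        have := hP (u i + u j)
        rw [hadd₁, hadd₂, hadd₂, hP, hP] at this
        linear_combination this
      rw [pairing_add_left (integrable_comp_swap (hF.integrable S) i j) (hF.integrable S), hswap,
        comp_swap_eq_update]
      simp only [P, Function.update_eq_self, normPairing] at key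
      rw [← add_div, div_eq_zero_iff] at key
      exact key.resolve_right hprod

/-- Condition (iii) in weak form. -/
lemma ae_exchange_iff_normPairing (hF : IsWalshExpansion f F) {S : Finset (Fin m)} {l : Fin m}
    (hl : l ∉ S) :
    (∀ᵐ x : Fin m → I, F S x / ((∏ i ∈ S, α i : ℝ) : ℂ) =
      ∑ i ∈ S, F ((S ∪ {l}) \ {i}) (x ∘ Equiv.swap l i) /
        ((∏ j ∈ (S ∪ {l}) \ {i}, α j : ℝ) : ℂ)) ↔
    ∀ u : Fin m → SimpleFunc I ℝ, normPairing α F S u =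
      ∑ i ∈ S, normPairing α F ((S ∪ {l}) \ {i}) (Function.update u l (u i)) := by
  have hint : ∀ i ∈ S, Integrable (fun x : Fin m → I =>
      F ((S ∪ {l}) \ {i}) (x ∘ Equiv.swap l i) / ((∏ j ∈ (S ∪ {l}) \ {i}, α j : ℝ) : ℂ)) volume :=
    fun i _ => (integrable_comp_swap (hF.integrable _) l i).div_const _
  have hright : ∀ u, pairing (fun x => ∑ i ∈ S, F ((S ∪ {l}) \ {i}) (x ∘ Equiv.swap l i) /
        ((∏ j ∈ (S ∪ {l}) \ {i}, α j : ℝ) : ℂ)) S u =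
      ∑ i ∈ S, normPairing α F ((S ∪ {l}) \ {i}) (Function.update u l (u i)) := fun u => by
    rw [pairing_sum_left S hint]
    refine Finset.sum_congr rfl fun i hi => ?_
    rw [pairing_div_left _ S u, pairing_comp_swap l i S u, map_swap_eq_union_sdiff hl hi,
      ← normPairing]
    refine normPairing_congr fun j hj => ?_
    have hji : j ≠ i := by simpa using (Finset.mem_sdiff.1 hj).2
    rw [comp_swap_eq_update, Function.update_of_ne hji]
  have hleft : ∀ u, pairing (fun x => F S x / ((∏ i ∈ S, α i : ℝ) : ℂ)) S u =
      normPairing α F S u := fun u => pairing_div_left _ S u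
  constructor
  · intro h u
    rw [← hleft, ← hright, pairing_congr_ae h]
  · intro h
    have hzero := ae_eq_zero_of_pairing_eq_zero (T := S)
      (((hF.integrable S).div_const ((∏ i ∈ S, α i : ℝ) : ℂ)).sub (integrable_finsetSum S hint))
      (fun k hk x t => ?_) fun u => ?_
    · filter_upwards [hzero] with x hx
      exact sub_eq_zero.1 hx
    · simp only [Pi.sub_apply]
      rw [hF.update_eq hk]
      congr 1
      refine Finset.sum_congr rfl fun i hi => ?_
      congr 1
      refine hF.dependsOn _ fun r hr => ?_
      have : Equiv.swap l i r ∈ S := by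
        rw [Finset.mem_coe, ← map_swap_eq_union_sdiff hl hi] at hr
        obtain ⟨j, hj, rfl⟩ := Finset.mem_map.1 hr
        simpa using hj
      exact Function.update_of_ne (ne_of_mem_of_not_mem this hk) _ _
    · have := pairing_sub_left ((hF.integrable S).div_const ((∏ i ∈ S, α i : ℝ) : ℂ))
        (integrable_finsetSum S hint) S u
      rw [hleft, hright, h u, sub_self] at this
      exact this

/-! ### Necessity: extracting multidegrees -/

/-- Test functions that agree with `u` on `S`, vanish outside `S ∪ {l}` and have sum zero. -/
noncomputable def balance (S : Finset (Fin m)) (l : Fin m) (u : Fin m → SimpleFunc I ℝ) :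
    Fin m → SimpleFunc I ℝ :=
  Function.update (fun i => if i ∈ S then u i else 0) l (-∑ i ∈ S, u i)

lemma sum_balance {S : Finset (Fin m)} {l : Fin m} (hl : l ∉ S) (u : Fin m → SimpleFunc I ℝ) :
    ∑ i, balance S l u i = 0 := by
  unfold balance
  rw [Finset.sum_update_of_mem (Finset.mem_univ l), Finset.sum_ite_mem,
    Finset.inter_eq_right.2 fun i hi => by simpa using ne_of_mem_of_not_mem hi hl]
  simp

lemma balance_of_notMem {S : Finset (Fin m)} {l i : Fin m} (hi : i ∉ insert l S)
    (u : Fin m → SimpleFunc I ℝ) : balance S l u i = 0 := by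
  rw [Finset.mem_insert, not_or] at hi
  simp [balance, hi.1, hi.2]

lemma balance_of_mem_insert {S : Finset (Fin m)} {l i : Fin m} (hi : i ∈ insert l S)
    (u : Fin m → SimpleFunc I ℝ) :
    balance S l u i = Function.update u l (-∑ j ∈ S, u j) i := by
  rcases eq_or_ne i l with rfl | hil
  · simp [balance]
  · simp [balance, hil, Finset.mem_of_mem_insert_of_ne hi hil]

lemma normPairing_balance (hF : IsWalshExpansion f F) {S T : Finset (Fin m)} {l : Fin m}
    (hlT : l ∈ T) (hT : T ⊆ insert l S) (u : Fin m → SimpleFunc I ℝ) :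
    normPairing α F T (balance S l u) =
      -∑ j ∈ S, normPairing α F T (Function.update u l (u j)) := by
  rw [← normPairing_update_neg_sum hF hlT]
  exact normPairing_congr fun i hi => balance_of_mem_insert (hT hi) u

/-- Extraction of the part of the degree identity that is quadratic in one test function. -/
lemma normPairing_eq_zero_of_eq (hF : IsWalshExpansion f F)
    (h : ∀ u : Fin m → SimpleFunc I ℝ, ∑ i, u i = 0 → ∀ k,
      ∑ S ∈ Finset.powersetCard k Finset.univ, normPairing α F S u = 0)
    {T : Finset (Fin m)} {l j : Fin m} (hl : l ∈ T) (hj : j ∈ T) (hlj : l ≠ j)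
    {u : Fin m → SimpleFunc I ℝ} (hu : u l = u j) : normPairing α F T u = 0 := by
  have hsum : ∀ u, ∑ i ∈ T.erase l, normPairing α F T (Function.update u l (u i)) = 0 := by
    intro u
    have h0 := h (balance (T.erase l) l u) (sum_balance (Finset.notMem_erase l T) u) T.card
    rw [Finset.sum_eq_single T, normPairing_balance hF hl (by rw [Finset.insert_erase hl]),
      neg_eq_zero] at h0
    · exact h0
    · intro S hS hST
      have hcard := (Finset.mem_powersetCard.1 hS).2
      obtain ⟨i, hiS, hiT⟩ : ∃ i ∈ S, i ∉ T := Finset.not_subset.1 fun hsub =>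
        hST (Finset.eq_of_subset_of_card_le hsub hcard.ge)
      exact normPairing_eq_zero_of_test_eq_zero hiS
        (balance_of_notMem (by rwa [Finset.insert_erase hl]) u)
    · simp
  have hjl : j ∈ T.erase l := Finset.mem_erase.2 ⟨hlj.symm, hj⟩
  -- Changing the sign of `u j` preserves only the summand in which `u j` occurs twice.
  have h1 := hsum u
  have h2 := hsum (Function.update u j (-u j))
  rw [← Finset.add_sum_erase _ _ hjl] at h1 h2
  have hsq : normPairing α F T (Function.update (Function.update u j (-u j)) l
      (Function.update u j (-u j) j)) = normPairing α F T (Function.update u l (u j)) := by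
    rw [Function.update_self, normPairing_update_neg hF hl, Function.update_comm hlj.symm,
      normPairing_update_neg hF hj, neg_neg]
    congr 1
    rw [Function.update_eq_iff]
    simp [hlj.symm]
  have hlin : ∀ i ∈ (T.erase l).erase j, normPairing α F T (Function.update
      (Function.update u j (-u j)) l (Function.update u j (-u j) i)) =
      -normPairing α F T (Function.update u l (u i)) := fun i hi => by
    rw [Function.update_of_ne (Finset.ne_of_mem_erase hi), Function.update_comm hlj.symm,
      normPairing_update_neg hF hj]
    congr 2
    rw [Function.update_eq_iff]
    simp [hlj.symm]
  rw [hsq, Finset.sum_congr rfl hlin, Finset.sum_neg_distrib] at h2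
  have h3 : normPairing α F T (Function.update u l (u j)) = 0 := by
    linear_combination (h1 + h2) / 2
  rwa [← hu, Function.update_eq_self] at h3

lemma card_union_sdiff_singleton {S : Finset (Fin m)} {l i : Fin m} (hl : l ∉ S) (hi : i ∈ S) :
    ((S ∪ {l}) \ {i}).card = S.card := by
  rw [← map_swap_eq_union_sdiff hl hi, Finset.card_map]

lemma mem_union_sdiff_singleton {S : Finset (Fin m)} {l i : Fin m} (hl : l ∉ S) (hi : i ∈ S) :
    l ∈ (S ∪ {l}) \ {i} := by
  simpa using (ne_of_mem_of_not_mem hi hl).symm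

/-- The sets of size `#S` inside `S ∪ {l}` are `S` and the sets obtained from it by exchanging one
element for `l`. -/
lemma eq_or_eq_union_sdiff_of_card_eq {S T : Finset (Fin m)} {l : Fin m} (hl : l ∉ S)
    (hT : T ⊆ insert l S) (hcard : T.card = S.card) :
    T = S ∨ ∃ i ∈ S, (S ∪ {l}) \ {i} = T := by
  by_cases hlT : l ∈ T
  · right
    obtain ⟨i, hiS, hiT⟩ : ∃ i ∈ S, i ∉ T := Finset.not_subset.1 fun hsub => by
      have := Finset.card_le_card (Finset.insert_subset hlT hsub)
      rw [Finset.card_insert_of_notMem hl] at this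
      omega
    refine ⟨i, hiS, (Finset.eq_of_subset_of_card_le (fun k hk => ?_) ?_).symm⟩
    · have hki : k ≠ i := ne_of_mem_of_not_mem hk hiT
      simpa [hki, or_comm] using hT hk
    · rw [card_union_sdiff_singleton hl hiS, hcard]
  · left
    exact Finset.eq_of_subset_of_card_le ((Finset.subset_insert_iff_of_notMem hlT).1 hT) hcard.ge

/-- Extraction of the part of the degree identity that is linear in each test function. -/
lemma normPairing_exchange (hF : IsWalshExpansion f F)
    (h : ∀ u : Fin m → SimpleFunc I ℝ, ∑ i, u i = 0 → ∀ k,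
      ∑ S ∈ Finset.powersetCard k Finset.univ, normPairing α F S u = 0)
    {S : Finset (Fin m)} {l : Fin m} (hl : l ∉ S) (u : Fin m → SimpleFunc I ℝ) :
    normPairing α F S u =
      ∑ i ∈ S, normPairing α F ((S ∪ {l}) \ {i}) (Function.update u l (u i)) := by
  have h0 := h (balance S l u) (sum_balance hl u) S.card
  have hSnot : S ∉ S.image fun i => (S ∪ {l}) \ {i} := fun hS => by
    obtain ⟨i, hi, hiS⟩ := Finset.mem_image.1 hS
    exact hl (hiS ▸ mem_union_sdiff_singleton hl hi)
  have hinj : Set.InjOn (fun i => (S ∪ {l}) \ {i}) (S : Set (Fin m)) := fun i hi j hj hij => by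
    by_contra hne
    have : i ∈ (S ∪ {l}) \ {j} := by simpa [hne] using Or.inr hi
    rw [← show (S ∪ {l}) \ {i} = (S ∪ {l}) \ {j} from hij] at this
    simp at this
  rw [← Finset.sum_subset (s₁ := insert S (S.image fun i => (S ∪ {l}) \ {i})),
    Finset.sum_insert hSnot, Finset.sum_image hinj] at h0
  · have hS : normPairing α F S (balance S l u) = normPairing α F S u :=
      normPairing_congr fun i hi => by
        rw [balance_of_mem_insert (Finset.mem_insert_of_mem hi),
          Function.update_of_ne (ne_of_mem_of_not_mem hi hl)]
    rw [hS, Finset.sum_congr rfl fun i hi => normPairing_balance hF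
      (mem_union_sdiff_singleton hl hi) (fun k hk => by
        simpa [or_comm] using (Finset.mem_sdiff.1 hk).1) u, Finset.sum_neg_distrib,
      add_neg_eq_zero] at h0
    rw [h0]
    refine Finset.sum_congr rfl fun i hi => Finset.sum_eq_single i (fun j hj hji => ?_) ?_
    · have hlj : l ≠ j := (ne_of_mem_of_not_mem hj hl).symm
      exact normPairing_eq_zero_of_eq hF h (mem_union_sdiff_singleton hl hi)
        (by simp [hj, hji]) hlj (by simp [hlj.symm])
    · exact fun h => absurd hi h
  · intro T hT
    rw [Finset.mem_powersetCard_univ]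
    rcases Finset.mem_insert.1 hT with rfl | hT
    · rfl
    · obtain ⟨i, hi, rfl⟩ := Finset.mem_image.1 hT
      exact card_union_sdiff_singleton hl hi
  · intro T hT hTnot
    obtain ⟨i, hiT, hi⟩ : ∃ i ∈ T, i ∉ insert l S := Finset.not_subset.1 fun hsub => by
      refine hTnot ?_
      rcases eq_or_eq_union_sdiff_of_card_eq hl hsub (Finset.mem_powersetCard_univ.1 hT) with
        rfl | ⟨i, hi, rfl⟩
      · exact Finset.mem_insert_self _ _
      · exact Finset.mem_insert_of_mem (Finset.mem_image_of_mem _ hi)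
    exact normPairing_eq_zero_of_test_eq_zero hiT (balance_of_notMem hi u)

/-! ### Sufficiency -/

/-- The weak forms of the three conditions imply that all pairings with balanced test functions sum
up to zero. -/
lemma sum_normPairing_eq_zero (hF : IsWalshExpansion f F) (l : Fin m)
    (hempty : ∀ u, normPairing α F ∅ u = 0)
    (halt : ∀ S : Finset (Fin m), ∀ i ∈ S, ∀ j ∈ S, i ≠ j → ∀ u : Fin m → SimpleFunc I ℝ,
      u i = u j → normPairing α F S u = 0)
    (hexch : ∀ S : Finset (Fin m), S.Nonempty → l ∉ S → ∀ u : Fin m → SimpleFunc I ℝ,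
      normPairing α F S u =
        ∑ i ∈ S, normPairing α F ((S ∪ {l}) \ {i}) (Function.update u l (u i)))
    {u : Fin m → SimpleFunc I ℝ} (hu : ∑ i, u i = 0) : ∑ S, normPairing α F S u = 0 := by
  have hmem : ∀ T, l ∈ T → normPairing α F T u =
      -∑ j ∈ Tᶜ, normPairing α F T (Function.update u l (u j)) := fun T hlT => by
    have hul : u l = -∑ j ∈ Finset.univ.erase l, u j := by
      rw [eq_neg_iff_add_eq_zero, Finset.add_sum_erase _ _ (Finset.mem_univ l), hu]
    conv_lhs => rw [← Function.update_eq_self l u, hul]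
    rw [normPairing_update_neg_sum hF hlT, neg_inj]
    symm
    refine Finset.sum_subset (fun j hj => ?_) fun j hj hjT => ?_
    · simpa using (ne_of_mem_of_not_mem hlT (Finset.mem_compl.1 hj)).symm
    · have hjl := Finset.ne_of_mem_erase hj
      exact halt T l hlT j (by simpa using hjT) hjl.symm _ (by simp [hjl])
  have hnotMem : ∀ S, l ∉ S → normPairing α F S u =
      ∑ i ∈ S, normPairing α F ((S ∪ {l}) \ {i}) (Function.update u l (u i)) := fun S hlS => by
    rcases S.eq_empty_or_nonempty with rfl | hS
    · simp [hempty]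
    · exact hexch S hS hlS u
  rw [← Finset.sum_filter_add_sum_filter_not _ (fun S => l ∈ S),
    Finset.sum_congr rfl fun T hT => hmem T (Finset.mem_filter.1 hT).2,
    Finset.sum_congr rfl fun S hS => hnotMem S (Finset.mem_filter.1 hS).2,
    Finset.sum_neg_distrib, neg_add_eq_zero, Finset.sum_sigma', Finset.sum_sigma']
  -- Exchanging `j ∉ T` for `l ∈ T` gives the set `S` not containing `l`, and conversely.
  refine Finset.sum_bij' (fun p _ => ⟨(p.1 ∪ {p.2}) \ {l}, p.2⟩)
    (fun p _ => ⟨(p.1 ∪ {l}) \ {p.2}, p.2⟩) ?_ ?_ ?_ ?_ ?_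
  · rintro ⟨T, j⟩ h
    simp only [Finset.mem_sigma, Finset.mem_filter_univ, Finset.mem_compl] at h ⊢
    have : j ≠ l := (ne_of_mem_of_not_mem h.1 h.2).symm
    simp [this]
  · rintro ⟨S, i⟩ h
    simp only [Finset.mem_sigma, Finset.mem_filter_univ, Finset.mem_compl] at h ⊢
    have : l ≠ i := (ne_of_mem_of_not_mem h.2 h.1).symm
    simp [this]
  · rintro ⟨T, j⟩ h
    simp only [Finset.mem_sigma, Finset.mem_filter_univ, Finset.mem_compl] at h ⊢
    congr 1
    ext k
    by_cases hkl : k = l <;> by_cases hkj : k = j <;> simp_all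
  · rintro ⟨S, i⟩ h
    simp only [Finset.mem_sigma, Finset.mem_filter_univ] at h ⊢
    congr 1
    ext k
    by_cases hkl : k = l <;> by_cases hki : k = i <;> simp_all
  · rintro ⟨T, j⟩ h
    simp only [Finset.mem_sigma, Finset.mem_filter_univ, Finset.mem_compl] at h ⊢
    congr 1
    ext k
    by_cases hkl : k = l <;> by_cases hkj : k = j <;> simp_all

end Conditions

/-! ### The characterization -/

theorem theorem1 (m : ℕ) (α : Fin m → ℝ) (hα : ∀ i, α i ∈ Set.Ioo (0 : ℝ) 1)
    (hsum : ∑ i, α i = 1) (f : (Fin m → I) → ℂ) (hf : Integrable f volume)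
    (F : Finset (Fin m) → (Fin m → I) → ℂ) (hF : IsWalshExpansion f F) :
    (∀ A : Fin m → Set I, IsMeasurePartition α A → ∫ x in Set.univ.pi A, f x = 0) ↔
      F ∅ = 0 ∧
      (∀ S : Finset (Fin m), 2 ≤ S.card → IsAlternatingOn (F S) S) ∧
      (∀ S : Finset (Fin m), 1 ≤ S.card → S.card < m → ∀ l ∉ S, ∀ᵐ x : Fin m → I,
        F S x / ((∏ i ∈ S, α i : ℝ) : ℂ) =
          ∑ i ∈ S, F ((S ∪ {l}) \ {i}) (x ∘ Equiv.swap l i) /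
            ((∏ j ∈ (S ∪ {l}) \ {i}, α j : ℝ) : ℂ)) := by
  have hα0 : ∀ i, 0 < α i := fun i => (hα i).1
  have hαne : ∀ i, α i ≠ 0 := fun i => (hα0 i).ne'
  have hconst : ∀ x y, F ∅ x = F ∅ y := fun x y => hF.dependsOn ∅ (by simp)
  constructor
  · intro hA
    have h : ∀ u : Fin m → SimpleFunc I ℝ, ∑ i, u i = 0 → ∀ k,
        ∑ S ∈ Finset.powersetCard k Finset.univ, normPairing α F S u = 0 := fun u hu =>
      sum_normPairing_powersetCard_eq_zero hα0 hsum hf hF hA hu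
    refine ⟨?_, fun S _ => ?_, fun S _ _ l hl => ?_⟩
    · funext x
      have h0 := h 0 (by simp) 0
      simp only [Finset.powersetCard_zero, Finset.sum_singleton, normPairing, pairing,
        Finset.prod_empty, hconst _ x] at h0
      simpa using h0
    · exact (isAlternatingOn_iff_normPairing_eq_zero hαne hF S).2 fun i hi j hj hij u hu =>
        normPairing_eq_zero_of_eq hF h hi hj hij hu
    · exact (ae_exchange_iff_normPairing hF hl).2 fun u => normPairing_exchange hF h hl u
  · rintro ⟨hempty, halt, hexch⟩ A hA
    obtain ⟨l⟩ : Nonempty (Fin m) := by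
      by_contra hne
      rw [not_nonempty_iff] at hne
      simp at hsum
    let v : Fin m → SimpleFunc I ℝ := fun i =>
      indicatorTest (A i) (hA.measurableSet i) - SimpleFunc.const I (α i)
    have hvol : ∀ i, volume.real (A i) = α i := fun i => by
      rw [measureReal_def, hA.volume_eq, ENNReal.toReal_ofReal (hα0 i).le]
    have hv : ∑ i, v i = 0 := by
      ext t
      obtain ⟨j, hj⟩ := Set.mem_iUnion.1 (hA.iUnion_eq.symm ▸ Set.mem_univ t)
      rw [simpleFunc_sum_apply]
      simp only [v, SimpleFunc.sub_apply, indicatorTest_apply, SimpleFunc.const_apply,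
        Finset.sum_sub_distrib, hsum]
      rw [Finset.sum_eq_single j]
      · simp [hj]
      · exact fun i _ hij => Set.indicator_of_notMem
          (fun hi => Set.disjoint_left.1 (hA.disjoint hij) hi hj) _
      · simp
    have hzero : ∑ S, normPairing α F S v = 0 := by
      refine sum_normPairing_eq_zero hF l (fun u => ?_) (fun S i hi j hj hij u hu => ?_)
        (fun S hS hl u => ?_) hv
      · simp [normPairing, pairing, hempty]
      · exact (isAlternatingOn_iff_normPairing_eq_zero hαne hF S).1
          (halt S (Finset.one_lt_card.2 ⟨i, hi, j, hj, hij⟩)) i hi j hj hij u hu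
      · have hlt : S.card < m := by
          simpa using Finset.card_lt_univ_of_notMem hl
        exact (ae_exchange_iff_normPairing hF hl).1 (hexch S hS.card_pos hlt l hl) u
    rw [← pairing_indicatorTest f hA.measurableSet,
      pairing_add_const_eq_sum hF hαne (v := v) (fun i t => by simp [v]) (fun i => ?_), hzero,
      mul_zero]
    simp only [v, SimpleFunc.sub_apply, SimpleFunc.const_apply]
    rw [integral_sub (integrable_simpleFunc _) (integrable_const _), integral_indicatorTest, hvol]
    simp
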